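/- A group is called Dedekind if all of its subgroups are normal. For a finite non-Dedekind group $G$ put \[ \mathrm{mni}(G)=\max\{|N_G(H):H| : H\le G,\ H\not\trianglelefteq G\}, \] \[ \mathrm{mni}^*(G)=\max\{|N_G(\langle g\rangle):\langle g\rangle| : g\in G,\ \langle g\rangle\not\trianglelefteq G\}, \] \[ \mathrm{mci}^*(G)=\max\{|C_G(g):\langle g\rangle| : g\in G,\ \langle g\rangle\not\trianglelefteq G\}. \] For a finite abelian $2$-group $A$, let $\Omega_1(A)$ be the subgroup generated by the elements of order at most $2$, and write $a^b=b^{-1}ab$. Consider finite $2$-groups of the form $G=\langle b,A\rangle$, where $A$ is a normal abelian subgroup of $G$ and $b^2\in\Omega_1(A)$. The family $\mathcal F_1$ consists of all such groups $G$ for which $A$ and $b$ can be chosen so that $A$ has exponent $2^n$ and $a^b=a^s$ for every $a\in A$, where either $s=-1$ and $n\ge 1$, or $s=-1+2^{n-1}$ and $n\ge 3$. The family $\mathcal F_2$ consists of all such groups $G$ for which $A$ and $b$ can be chosen so that $A=\langle a_1\rangle\times A^*$, where $a_1$ has order $2^n$, $A^*$ is non-trivial of order $2^m$, and, for some $z\in\Omega_1(A^*)$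 with $z\ne 1$, one has $a_1^b=a_1^s z$ and $(a^*)^b=(a^*)^s$ for every $a^*\in A^*$, where either $s=-1$ and $n\ge 2$, or $s=-1+2^{n-1}$, $n\ge 3$ and $n\ge m$. Theorem B. There exists a polynomial $f$ of degree four, with non-negative integer coefficients, such that the following holds for every integer $k\ge 0$ and every non-Dedekind finite $2$-group $G$ with $\mathrm{mni}(G)=2^k$, $\mathrm{mni}^*(G)=2^k$ or $\mathrm{mci}^*(G)=2^k$: if $|G|>2^{f(k)}$, then $G$ belongs to $\mathcal F_1$ or to $\mathcal F_2$. -/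

import Mathlib

section Invariants

/-- A group is Dedekind if all its subgroups are normal. -/
def IsDedekindGroup (G : Type*) [Group G] : Prop :=
  ∀ H : Subgroup G, H.Normal

/-- The maximum of the indices `|N_G(H) : H|` over the non-normal subgroups `H` of `G`.
For a finite non-Dedekind group the set is finite and non-empty, so that the supremum is a
maximum. -/
noncomputable def mni (G : Type*) [Group G] : ℕ :=
  sSup {i : ℕ | ∃ H : Subgroup G, ¬ H.Normal ∧
    i = H.relIndex (Subgroup.normalizer (H : Set G))}

/-- The maximum of the indices `|N_G(⟨g⟩) : ⟨g⟩|` over the `g` with `⟨g⟩` not normal in `G`. -/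
noncomputable def mniStar (G : Type*) [Group G] : ℕ :=
  sSup {i : ℕ | ∃ g : G, ¬ (Subgroup.zpowers g).Normal ∧
    i = (Subgroup.zpowers g).relIndex
      (Subgroup.normalizer (Subgroup.zpowers g : Set G))}

/-- The maximum of the indices `|C_G(g) : ⟨g⟩|` over the `g` with `⟨g⟩` not normal in `G`. -/
noncomputable def mciStar (G : Type*) [Group G] : ℕ :=
  sSup {i : ℕ | ∃ g : G, ¬ (Subgroup.zpowers g).Normal ∧
    i = (Subgroup.zpowers g).relIndex (Subgroup.centralizer {g})}

end Invariants

section Families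

/-- `Ω₁(A)` for a subgroup `A` of a `2`-group: the subgroup generated by the elements of `A` of
order at most `2`. -/
def omegaOne {G : Type*} [Group G] (A : Subgroup G) : Subgroup G :=
  Subgroup.closure {a : G | a ∈ A ∧ a ^ 2 = 1}

/-- The shape common to both families: `G = ⟨b, A⟩`, where `A` is normal and abelian and
`b² ∈ Ω₁(A)`. -/
def IsBasicExtension {G : Type*} [Group G] (A : Subgroup G) (b : G) : Prop :=
  A.Normal ∧ (∀ x ∈ A, ∀ y ∈ A, x * y = y * x) ∧
    Subgroup.closure (insert b (A : Set G)) = ⊤ ∧ b ^ 2 ∈ omegaOne A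

/-- The family `𝓕₁`: `A` has exponent `2ⁿ`, and `a^b = b⁻¹ab = a^s` for all `a ∈ A`, where
`s = -1` and `n ≥ 1`, or `s = -1 + 2ⁿ⁻¹` and `n ≥ 3`. -/
def InFamilyOne (G : Type*) [Group G] : Prop :=
  Finite G ∧ IsPGroup 2 G ∧
  ∃ (A : Subgroup G) (b : G) (n : ℕ) (s : ℤ),
    IsBasicExtension A b ∧
    Monoid.exponent A = 2 ^ n ∧
    ((s = -1 ∧ 1 ≤ n) ∨ (s = -1 + 2 ^ (n - 1) ∧ 3 ≤ n)) ∧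
    ∀ a ∈ A, b⁻¹ * a * b = a ^ s

/-- The family `𝓕₂`: `A = ⟨a₁⟩ × B` is an (internal) direct product, `a₁` has order `2ⁿ`, `B` is
non-trivial of order `2ᵐ`, `z` is a non-trivial element of `Ω₁(B)`, and `b` acts on `A` by
`a₁^b = a₁^s z` and `a^b = a^s` for all `a ∈ B`, where `s = -1` and `n ≥ 2`, or
`s = -1 + 2ⁿ⁻¹`, `n ≥ 3` and `n ≥ m`. -/
def InFamilyTwo (G : Type*) [Group G] : Prop :=
  Finite G ∧ IsPGroup 2 G ∧
  ∃ (A B : Subgroup G) (a₁ z b : G) (n m : ℕ) (s : ℤ),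
    IsBasicExtension A b ∧
    Subgroup.zpowers a₁ ⊔ B = A ∧ Subgroup.zpowers a₁ ⊓ B = ⊥ ∧
    orderOf a₁ = 2 ^ n ∧ Nat.card B = 2 ^ m ∧ B ≠ ⊥ ∧
    z ∈ omegaOne B ∧ z ≠ 1 ∧
    ((s = -1 ∧ 2 ≤ n) ∨ (s = -1 + 2 ^ (n - 1) ∧ 3 ≤ n ∧ m ≤ n)) ∧
    b⁻¹ * a₁ * b = a₁ ^ s * z ∧
    ∀ a ∈ B, b⁻¹ * a * b = a ^ s

end Families

/-!
Write `(*)` for the condition `|C_G(g) : ⟨g⟩| ≤ 2 ^ k` whenever `⟨g⟩` is not normal. Each of the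
three invariants being `2 ^ k` implies `(*)`, since `C_G(g) ≤ N_G(⟨g⟩)`, and nothing else about
them is used.

Let `A` be a maximal normal abelian subgroup, so that `C_G(A) = A`, and let `2 ^ n` be its exponent.
By `(*)`, a normal elementary abelian subgroup has order at most `2 ^ (2 * k + 2)`
(`card_elementary_le`). Hence `|A| ≤ 2 ^ N` with `N = (2 * k + 2) * n`, and as `G / A` embeds in
`Aut A`, where `A` has at most `N` generators, `|G| ≤ 2 ^ (N + N ^ 2)`
(`card_le_of_small_exponent`). If `n ≤ 3 * k + 4`, this is at most `2 ^ (72 * (k + 1) ^ 4)`.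

Suppose now that `n ≥ 3 * k + 5`, and write `A = ⟨a⟩ × B` with `|a| = 2 ^ n`. If some `⟨x⟩` with
`x ∈ A` is not normal in `G`, then `A ≤ C_G(x)` and `(*)` give `|A : ⟨x⟩| ≤ 2 ^ k`; therefore
`|B| ≤ 2 ^ k`, and all elements of `A` of order at most `2 ^ (n - k - 1)` generate normal subgroups.
In any case each `g ∈ G` raises all these elements to the same power `s`
(`IsLargeSplitting.exists_actsAsPower`).

The key point is that `s ≡ 1` modulo `4` only for `g ∈ A`
(`IsLargeSplitting.mem_of_actsAsPower_one`). One may suppose that `g ^ 2 ∈ A`; then `g` centralizes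
the elements of `A` of order at most `2 ^ (n - k - 2)`. After multiplication of `g` by an element
of `A`, either `g ^ 2` has order `2 ^ n` and this forces `g` to centralize `A`, or `g ^ 2 ∈ B`. In
the second case `g`, and also its product with an element of `⟨a⟩` of order `2 ^ (k + 1)` when
`|B| ≤ 2 ^ k`, have a large centralizer modulo the cyclic subgroup that they generate, so that by
`(*)` these cyclic subgroups are normal; their intersection is too small for that, unless `g`
centralizes `A`.

It follows that `|G : A| = 2` and that an element `b` outside `A` acts with `s ≡ -1` modulo `4`.
Then `b ^ 2` has order at most two, and the relation `b ^ 2 ∈ A` leaves only the exponents `-1` and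
`-1 + 2 ^ (n - 1)`. If all cyclic subgroups of `A` are normal, `G` is in the first family, otherwise
in the second.
-/

/-! ### Finite abelian groups and self-centralizing subgroups -/

/-- In a finite abelian group, a cyclic subgroup whose order is the exponent is a direct factor: a
faithful character of `⟨a⟩` extends to the whole group, and the kernel of the extension is a
complement. -/
theorem exists_complement_zpowers {A : Type*} [CommGroup A] [Finite A] (a : A)
    (ha : ∀ x : A, x ^ orderOf a = 1) :
    ∃ B : Subgroup A, Subgroup.zpowers a ⊔ B = ⊤ ∧ Subgroup.zpowers a ⊓ B = ⊥ := by
  classical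
  have hpos : 0 < orderOf a := orderOf_pos a
  have : NeZero (orderOf a) := ⟨hpos.ne'⟩
  have : NeZero (Monoid.exponent A) := ⟨Monoid.exponent_ne_zero_of_finite⟩
  have : HasEnoughRootsOfUnity Circle (Monoid.exponent A) := inferInstance
  obtain ⟨e⟩ : Nonempty (Subgroup.zpowers a ≃* rootsOfUnity (orderOf a) Circle) := by
    have h1 : IsCyclic (rootsOfUnity (orderOf a) Circle) := inferInstance
    refine ⟨mulEquivOfCyclicCardEq ?_⟩
    rw [Nat.card_zpowers, HasEnoughRootsOfUnity.natCard_rootsOfUnity]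
  let χ : Subgroup.zpowers a →* Circleˣ :=
    (rootsOfUnity (orderOf a) Circle).subtype.comp e.toMonoidHom
  obtain ⟨ψ, hψ⟩ := MonoidHom.domRestrict_surjective Circle (Subgroup.zpowers a) χ
  refine ⟨ψ.ker, ?_, ?_⟩
  · rw [eq_top_iff]
    intro x _
    have hx : ψ x ∈ rootsOfUnity (orderOf a) Circle := by
      rw [mem_rootsOfUnity, ← map_pow, ha, map_one]
    obtain ⟨y, hy⟩ := e.surjective ⟨ψ x, hx⟩
    have hy' : ψ y = ψ x := by
      have := DFunLike.congr_fun hψ y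
      change ψ y = _ at this
      rw [this]
      simp [χ, hy]
    have : x = y * ((y : A)⁻¹ * x) := by group
    rw [this]
    refine Subgroup.mul_mem_sup y.2 ?_
    rw [MonoidHom.mem_ker, map_mul, map_inv, hy', inv_mul_cancel]
  · rw [eq_bot_iff]
    rintro x ⟨hx, hx'⟩
    have h2 : χ ⟨x, hx⟩ = 1 := by
      rw [← hψ]; exact hx'
    have h3 : e ⟨x, hx⟩ = 1 := by
      apply Subtype.ext
      simpa [χ] using h2
    have := (map_eq_one_iff e e.injective).1 h3
    simpa using congrArg Subtype.val this

/-- In a finite `p`-group, a normal abelian subgroup of maximal order contains its centralizer. -/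
theorem exists_normal_abelian_selfCentralizing {p : ℕ} [Fact p.Prime] {G : Type*} [Group G]
    [Finite G] (hG : IsPGroup p G) :
    ∃ A : Subgroup G, A.Normal ∧ (∀ x ∈ A, ∀ y ∈ A, x * y = y * x) ∧
      ∀ g : G, (∀ x ∈ A, g * x = x * g) → g ∈ A := by
  classical
  obtain ⟨A, ⟨hN, hc⟩, hmax⟩ := (Set.toFinite
    {A : Subgroup G | A.Normal ∧ ∀ x ∈ A, ∀ y ∈ A, x * y = y * x}).exists_maximal
    ⟨⊥, inferInstance, by simp⟩
  refine ⟨A, hN, hc, ?_⟩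
  by_contra hcon
  push Not at hcon
  obtain ⟨g, hg, hgA⟩ := hcon
  let C := Subgroup.centralizer (A : Set G)
  let N := C.map (QuotientGroup.mk' A)
  have hNn : N.Normal := Subgroup.Normal.map inferInstance _ (QuotientGroup.mk'_surjective A)
  have hgN : (QuotientGroup.mk' A g) ∈ N :=
    Subgroup.mem_map_of_mem _ (by
      rw [Subgroup.mem_centralizer_iff]; intro x hx; exact (hg x hx).symm)
  have hNt : Nontrivial N := by
    refine ⟨⟨⟨_, hgN⟩, 1, fun h => hgA ?_⟩⟩
    have := congrArg Subtype.val h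
    simpa using this
  have hQ : IsPGroup p (G ⧸ A) := hG.to_quotient A
  have hdvd : p ∣ Nat.card N := by
    rcases (hQ.to_subgroup N).card_eq_or_dvd with h | h
    · exact absurd h (Finite.one_lt_card).ne'
    · exact h
  have hQ' : IsPGroup p (ConjAct (G ⧸ A)) := hQ.of_equiv ConjAct.toConjAct
  obtain ⟨y, hy, hy1⟩ := hQ'.exists_fixed_point_of_prime_dvd_card_of_fixed_point N hdvd
    (a := 1) (by intro q; simp)
  obtain ⟨y, x, hxC, rfl⟩ := y
  have hxA : x ∉ A := fun h => hy1 (Subtype.ext ((QuotientGroup.eq_one_iff x).2 h).symm)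
  have hxc : ∀ h : G, ∃ a ∈ A, h * x * h⁻¹ = x * a := by
    intro h
    have h1 := congrArg Subtype.val (hy (ConjAct.toConjAct (QuotientGroup.mk' A h)))
    refine ⟨x⁻¹ * (h * x * h⁻¹), ?_, by group⟩
    rw [← QuotientGroup.eq]
    simpa [ConjAct.Subgroup.val_conj_smul, ConjAct.toConjAct_smul] using h1.symm
  have hxA' : ∀ a ∈ A, a * x = x * a := fun a ha => (Subgroup.mem_centralizer_iff.1 hxC) a ha
  let D := A ⊔ Subgroup.zpowers x
  have hD : ∀ d ∈ D, ∃ a ∈ A, ∃ i : ℤ, a * x ^ i = d := by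
    intro d hd
    obtain ⟨a, ha, w, hw, rfl⟩ := Subgroup.mem_sup_of_normal_left.1 hd
    obtain ⟨i, rfl⟩ := hw
    exact ⟨a, ha, i, rfl⟩
  have hxD : x ∈ D := Subgroup.mem_sup_right (Subgroup.mem_zpowers x)
  have hAD : A ≤ D := le_sup_left
  have hDn : D.Normal := by
    refine ⟨fun d hd h => ?_⟩
    obtain ⟨a, ha, i, rfl⟩ := hD d hd
    obtain ⟨a', ha', hx'⟩ := hxc h
    have : h * (a * x ^ i) * h⁻¹ = (h * a * h⁻¹) * (h * x * h⁻¹) ^ i := by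
      rw [conj_zpow]; group
    rw [this, hx']
    exact D.mul_mem (hAD (hN.conj_mem a ha h)) (D.zpow_mem (D.mul_mem hxD (hAD ha')) i)
  have hDc : ∀ u ∈ D, ∀ v ∈ D, u * v = v * u := by
    intro u hu v hv
    obtain ⟨a, ha, i, rfl⟩ := hD u hu
    obtain ⟨c, hc', j, rfl⟩ := hD v hv
    have h1 : Commute a c := hc a ha c hc'
    have h2 : Commute a x := hxA' a ha
    have h3 : Commute c x := hxA' c hc'
    exact ((h1.mul_right (h2.zpow_right j)).mul_left
      ((h3.zpow_right i).symm.mul_right ((Commute.refl x).zpow_zpow i j)) : Commute _ _)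
  exact hxA (hmax ⟨hDn, hDc⟩ hAD hxD)

/-- A finite group whose order is at most `2 ^ N` is generated by at most `N` elements. -/
theorem exists_generating_finset_card_le {G : Type*} [Group G] [Finite G] {N : ℕ}
    (h : Nat.card G ≤ 2 ^ N) :
    ∃ S : Finset G, S.card ≤ N ∧ Subgroup.closure (S : Set G) = ⊤ := by
  classical
  have key : ∀ j : ℕ, ∃ S : Finset G, S.card ≤ j ∧
      (Subgroup.closure (S : Set G) = ⊤ ∨ 2 ^ j ≤ Nat.card (Subgroup.closure (S : Set G))) := by
    intro j
    induction j with
    | zero => exact ⟨∅, le_rfl, Or.inr Nat.card_pos⟩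
    | succ j ih =>
      obtain ⟨S, hS, hS' | hS'⟩ := ih
      · exact ⟨S, by omega, Or.inl hS'⟩
      by_cases ht : Subgroup.closure (S : Set G) = ⊤
      · exact ⟨S, by omega, Or.inl ht⟩
      obtain ⟨x, hx⟩ : ∃ x, x ∉ Subgroup.closure (S : Set G) := by
        by_contra hcon
        push Not at hcon
        exact ht (Subgroup.eq_top_iff' _ |>.2 hcon)
      refine ⟨insert x S, (Finset.card_insert_le _ _).trans (by omega), Or.inr ?_⟩
      have hle : Subgroup.closure (S : Set G) ≤
          Subgroup.closure ((insert x S : Finset G) : Set G) :=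
        Subgroup.closure_mono (by simp)
      obtain ⟨q, hq⟩ := Subgroup.card_dvd_of_le hle
      have hpos : 0 < Nat.card (Subgroup.closure ((insert x S : Finset G) : Set G)) := Nat.card_pos
      have hq2 : 2 ≤ q := by
        rcases q with _ | _ | q
        · omega
        · exfalso
          apply hx
          have := Subgroup.eq_of_le_of_card_ge hle (by omega)
          rw [this]
          exact Subgroup.subset_closure (by simp)
        · omega
      rw [hq, pow_succ]
      exact Nat.mul_le_mul hS' hq2
  obtain ⟨S, hS, hS' | hS'⟩ := key N
  · exact ⟨S, hS, hS'⟩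
  · exact ⟨S, hS, Subgroup.eq_top_of_card_eq _ (le_antisymm (Subgroup.card_le_card_group _)
      (h.trans hS'))⟩

/-- A finite abelian group of exponent dividing `2 ^ n` with at most `q` solutions of `x ^ 2 = 1`
has order at most `q ^ n`. -/
theorem card_le_pow_of_card_involutions_le {q : ℕ} : ∀ (n : ℕ) {A : Type*} [CommGroup A] [Finite A],
    (∀ x : A, x ^ 2 ^ n = 1) → Nat.card (powMonoidHom 2 : A →* A).ker ≤ q → Nat.card A ≤ q ^ n := by
  intro n
  induction n with
  | zero =>
    intro A _ _ hx _
    have : Subsingleton A := ⟨fun x y => by simpa using (hx x).trans (hx y).symm⟩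
    simp
  | succ n ih =>
    intro A _ _ hx hq
    let f : A →* A := powMonoidHom 2
    have h1 : Nat.card A = Nat.card f.range * Nat.card f.ker := by
      rw [← Subgroup.card_mul_index f.ker, Subgroup.index_ker, mul_comm]
    have h2 : Nat.card f.range ≤ q ^ n := by
      refine ih ?_ ?_
      · rintro ⟨_, y, rfl⟩
        apply Subtype.ext
        change (y ^ 2) ^ 2 ^ n = 1
        rw [← pow_mul, ← pow_succ', hx]
      · refine le_trans (Nat.card_le_card_of_injective
          (fun z : (powMonoidHom 2 : f.range →* f.range).ker => (⟨z.1.1, ?_⟩ : f.ker)) ?_) hq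
        · exact congrArg Subtype.val (MonoidHom.mem_ker.1 z.2)
        · intro z w h
          exact Subtype.ext (Subtype.ext (congrArg (Subtype.val : f.ker → A) h))
    rw [h1, pow_succ]
    exact Nat.mul_le_mul h2 hq

/-- A self-centralizing normal abelian subgroup bounds the order of the whole group. -/
theorem card_le_of_selfCentralizing {G : Type*} [Group G] [Finite G] (A : Subgroup G)
    (hN : A.Normal) (hself : ∀ g : G, (∀ x ∈ A, g * x = x * g) → g ∈ A) {N : ℕ}
    (hA : Nat.card A ≤ 2 ^ N) : Nat.card G ≤ 2 ^ (N + N * N) := by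
  obtain ⟨S, hS, hS'⟩ := exists_generating_finset_card_le hA
  have hle : (MulAut.conjNormal : G →* MulAut A).ker ≤ A := by
    intro g hg
    refine hself g fun x hx => ?_
    have := congrArg Subtype.val (DFunLike.congr_fun (MonoidHom.mem_ker.1 hg) ⟨x, hx⟩)
    simp only [MulAut.conjNormal_apply, MulAut.one_apply] at this
    rw [mul_inv_eq_iff_eq_mul] at this
    exact this
  -- an automorphism is determined by its values on generators
  have haut : Nat.card (MulAut A) ≤ (2 ^ N) ^ N := by
    have hinj : Function.Injective (fun φ : MulAut A => fun s : S => φ s.1) := by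
      intro φ ψ h
      have : φ.toMonoidHom = ψ.toMonoidHom :=
        MonoidHom.eq_of_eqOn_dense hS' fun s hs => congrFun h ⟨s, hs⟩
      ext x
      exact congrArg Subtype.val (DFunLike.congr_fun this x)
    calc Nat.card (MulAut A) ≤ Nat.card (S → A) := Nat.card_le_card_of_injective _ hinj
      _ = Nat.card A ^ S.card := by rw [Nat.card_fun]; simp
      _ ≤ Nat.card A ^ N := Nat.pow_le_pow_right Nat.card_pos hS
      _ ≤ (2 ^ N) ^ N := Nat.pow_le_pow_left hA N
  have hidx : (MulAut.conjNormal : G →* MulAut A).ker.index ≤ (2 ^ N) ^ N := by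
    rw [Subgroup.index_ker]
    exact (Subgroup.card_le_card_group _).trans haut
  calc Nat.card G = Nat.card (MulAut.conjNormal : G →* MulAut A).ker *
        (MulAut.conjNormal : G →* MulAut A).ker.index := (Subgroup.card_mul_index _).symm
    _ ≤ 2 ^ N * (2 ^ N) ^ N :=
      Nat.mul_le_mul ((Subgroup.card_le_of_le hle).trans hA) hidx
    _ = 2 ^ (N + N * N) := by rw [← pow_mul, ← pow_add]

/-! ### Consequences of the bound on centralizers -/

/-- A finite group with all cyclic subgroups normal is Dedekind. -/
theorem isDedekindGroup_of_zpowers_normal {G : Type*} [Group G]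
    (h : ∀ g : G, (Subgroup.zpowers g).Normal) : IsDedekindGroup G := by
  refine fun H => ⟨fun x hx g => ?_⟩
  exact (Subgroup.zpowers_le.2 hx) ((h x).conj_mem x (Subgroup.mem_zpowers x) g)

theorem zpowers_le_centralizer_singleton {G : Type*} [Group G] (g : G) :
    Subgroup.zpowers g ≤ Subgroup.centralizer {g} := by
  rw [Subgroup.zpowers_le, Subgroup.mem_centralizer_singleton_iff]

theorem centralizer_singleton_le_normalizer_zpowers {G : Type*} [Group G] (g : G) :
    Subgroup.centralizer {g} ≤ Subgroup.normalizer (Subgroup.zpowers g : Set G) := by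
  intro x hx
  have hx : x * g = g * x := (Subgroup.mem_centralizer_singleton_iff.1 hx)
  have hc : Commute x g := hx
  rw [Subgroup.mem_normalizer_iff]
  intro y
  constructor
  · rintro ⟨i, rfl⟩
    refine ⟨i, ?_⟩
    have := (hc.zpow_right i).eq
    simp only [this, mul_inv_cancel_right]
  · rintro ⟨i, hi⟩
    refine ⟨i, ?_⟩
    have := (hc.zpow_right i).eq
    simp only at hi
    rw [eq_mul_inv_iff_mul_eq, ← this] at hi
    exact mul_left_cancel hi

/-- Each of the three invariants bounds the orders of the centralizers of the elements that
generate non-normal subgroups. -/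
theorem card_centralizer_le {G : Type*} [Group G] [Finite G] {q : ℕ}
    (h : mni G = q ∨ mniStar G = q ∨ mciStar G = q) (g : G)
    (hg : ¬ (Subgroup.zpowers g).Normal) :
    Nat.card (Subgroup.centralizer {g}) ≤ q * orderOf g := by
  have hfin : ∀ H K : Subgroup G, H.relIndex K ≤ Nat.card G := fun H K =>
    (Nat.le_of_dvd Nat.card_pos (H.relIndex_dvd_card K)).trans (Subgroup.card_le_card_group _)
  have hle : (Subgroup.zpowers g).relIndex (Subgroup.centralizer {g}) ≤
      (Subgroup.zpowers g).relIndex (Subgroup.normalizer (Subgroup.zpowers g : Set G)) :=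
    Subgroup.relIndex_le_of_le_right (centralizer_singleton_le_normalizer_zpowers g)
      Subgroup.index_ne_zero_of_finite
  have key : (Subgroup.zpowers g).relIndex (Subgroup.centralizer {g}) ≤ q := by
    rcases h with h | h | h
    · refine hle.trans (h ▸ le_csSup ⟨Nat.card G, ?_⟩ ⟨_, hg, rfl⟩)
      rintro _ ⟨H, _, rfl⟩
      exact hfin _ _
    · refine hle.trans (h ▸ le_csSup ⟨Nat.card G, ?_⟩ ⟨_, hg, rfl⟩)
      rintro _ ⟨H, _, rfl⟩
      exact hfin _ _
    · refine h ▸ le_csSup ⟨Nat.card G, ?_⟩ ⟨_, hg, rfl⟩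
      rintro _ ⟨H, _, rfl⟩
      exact hfin _ _
  rw [← Subgroup.card_mul_index ((Subgroup.zpowers g).subgroupOf (Subgroup.centralizer {g})),
    Nat.card_congr (Subgroup.subgroupOfEquivOfLe (zpowers_le_centralizer_singleton g)).toEquiv,
    Nat.card_zpowers, mul_comm]
  exact Nat.mul_le_mul_right _ key

/-- A normal elementary abelian `2`-subgroup `E` has at most `2 ^ (2 * k + 2)` elements. A
non-normal subgroup of order two, generated by `g`, bounds `|C_E(g)|`, and `x ↦ x x^g` maps `E`
to `C_E(g)` with kernel `C_E(g)`. If there is none, `E` is central. -/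
theorem card_elementary_le {G : Type*} [Group G] [Finite G] {k : ℕ}
    (hC : ∀ g : G, ¬ (Subgroup.zpowers g).Normal →
      Nat.card (Subgroup.centralizer {g}) ≤ 2 ^ k * orderOf g)
    (hnd : ¬ IsDedekindGroup G) (E : Subgroup G) (hE : E.Normal)
    (hEc : ∀ x ∈ E, ∀ y ∈ E, x * y = y * x) (hE2 : ∀ x ∈ E, x ^ 2 = 1) :
    Nat.card E ≤ 2 ^ (2 * k + 2) := by
  by_cases hinv : ∃ g : G, g ^ 2 = 1 ∧ ¬ (Subgroup.zpowers g).Normal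
  · obtain ⟨g, hg2, hg⟩ := hinv
    have hgg : g⁻¹ = g := by
      rw [inv_eq_iff_mul_eq_one, ← sq, hg2]
    have hcard : Nat.card (Subgroup.centralizer {g}) ≤ 2 ^ (k + 1) := by
      refine (hC g hg).trans ?_
      rw [pow_succ]
      exact Nat.mul_le_mul_left _ (orderOf_le_of_pow_eq_one two_pos hg2)
    let f : E →* E :=
      { toFun := fun x => x * MulAut.conjNormal g x
        map_one' := by simp
        map_mul' := fun x y => by
          have h1 := hEc _ y.2 _ (MulAut.conjNormal g x).2
          apply Subtype.ext
          simp only [map_mul, Subgroup.coe_mul]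
          calc (x : G) * y * ((MulAut.conjNormal g x : E) * (MulAut.conjNormal g y : E))
              = x * (y * (MulAut.conjNormal g x : E)) * (MulAut.conjNormal g y : E) := by group
            _ = x * ((MulAut.conjNormal g x : E) * y) * (MulAut.conjNormal g y : E) := by rw [h1]
            _ = _ := by group }
    have hcent : ∀ x : E, (MulAut.conjNormal g x : E) = x → (x : G) ∈ Subgroup.centralizer {g} := by
      intro x hx
      rw [Subgroup.mem_centralizer_singleton_iff]
      have := congrArg Subtype.val hx
      rw [MulAut.conjNormal_apply, mul_inv_eq_iff_eq_mul] at this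
      exact this.symm
    have hcc : ∀ x : E, (MulAut.conjNormal g (MulAut.conjNormal g x) : E) = x := by
      intro x
      rw [← MulAut.mul_apply, ← map_mul, ← sq, hg2, map_one, MulAut.one_apply]
    have hker : Nat.card f.ker ≤ Nat.card (Subgroup.centralizer {g}) := by
      refine Nat.card_le_card_of_injective (fun z => ⟨(z.1 : G), hcent z.1 ?_⟩) ?_
      · have h1 : z.1 * MulAut.conjNormal g z.1 = 1 := z.2
        have h2 : z.1 * z.1 = 1 := Subtype.ext (by simpa [sq] using hE2 _ z.1.2)
        exact mul_left_cancel (h1.trans h2.symm)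
      · intro z w h
        exact Subtype.ext (Subtype.ext (congrArg (Subtype.val : Subgroup.centralizer {g} → G) h))
    have hran : Nat.card f.range ≤ Nat.card (Subgroup.centralizer {g}) := by
      refine Nat.card_le_card_of_injective (fun z => ⟨(z.1 : G), hcent z.1 ?_⟩) ?_
      · obtain ⟨_, y, rfl⟩ := z
        change MulAut.conjNormal g (y * MulAut.conjNormal g y) = y * MulAut.conjNormal g y
        rw [map_mul, hcc]
        exact Subtype.ext (hEc _ (MulAut.conjNormal g y).2 _ y.2)
      · intro z w h
        exact Subtype.ext (Subtype.ext (congrArg (Subtype.val : Subgroup.centralizer {g} → G) h))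
    calc Nat.card E = Nat.card f.ker * Nat.card f.range := by
          rw [← Subgroup.card_mul_index f.ker, Subgroup.index_ker]
      _ ≤ 2 ^ (k + 1) * 2 ^ (k + 1) :=
          Nat.mul_le_mul (hker.trans hcard) (hran.trans hcard)
      _ = 2 ^ (2 * k + 2) := by rw [← pow_add]; congr 1; ring
  · push Not at hinv
    obtain ⟨g, hg⟩ : ∃ g : G, ¬ (Subgroup.zpowers g).Normal := by
      by_contra hcon
      push Not at hcon
      exact hnd (isDedekindGroup_of_zpowers_normal hcon)
    have hEg : E ≤ Subgroup.centralizer {g} := by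
      intro x hx
      rw [Subgroup.mem_centralizer_singleton_iff]
      obtain ⟨i, hi⟩ := (hinv x (hE2 x hx)).conj_mem x (Subgroup.mem_zpowers x) g
      have hx2 := hE2 x hx
      simp only at hi
      rcases Int.even_or_odd i with ⟨j, rfl⟩ | ⟨j, rfl⟩
      · rw [← two_mul, zpow_mul, zpow_ofNat, hx2, one_zpow] at hi
        have : x = 1 := by
          have h1 : g * x * g⁻¹ = 1 := hi.symm
          simpa using h1
        simp [this]
      · rw [zpow_add, zpow_mul, zpow_ofNat, hx2, one_zpow, one_mul, zpow_one,
          eq_mul_inv_iff_mul_eq] at hi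
        exact hi
    -- `E` meets `⟨g⟩` in at most two elements
    have h1 : Nat.card E = (Subgroup.zpowers g).relIndex E *
        Nat.card ((Subgroup.zpowers g).subgroupOf E) := by
      rw [← Subgroup.card_mul_index ((Subgroup.zpowers g).subgroupOf E), mul_comm]; rfl
    have h2 : Nat.card ((Subgroup.zpowers g).subgroupOf E) ≤ 2 := by
      have hcyc : IsCyclic ((Subgroup.zpowers g).subgroupOf E) := by
        have : Function.Injective (fun z : (Subgroup.zpowers g).subgroupOf E =>
          (⟨(z.1 : G), z.2⟩ : Subgroup.zpowers g)) := by
            intro z w h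
            exact Subtype.ext (Subtype.ext (congrArg (Subtype.val : Subgroup.zpowers g → G) h))
        exact isCyclic_of_injective
          (⟨⟨fun z => ⟨(z.1 : G), z.2⟩, rfl⟩, fun _ _ => rfl⟩ :
            (Subgroup.zpowers g).subgroupOf E →* Subgroup.zpowers g) this
      obtain ⟨z, hz⟩ := IsCyclic.exists_ofOrder_eq_natCard (α := (Subgroup.zpowers g).subgroupOf E)
      rw [← hz]
      refine orderOf_le_of_pow_eq_one two_pos ?_
      exact Subtype.ext (Subtype.ext (hE2 _ z.1.2))
    have h3 : (Subgroup.zpowers g).relIndex E ≤ 2 ^ k := by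
      refine (Subgroup.relIndex_le_of_le_right hEg Subgroup.index_ne_zero_of_finite).trans ?_
      have := hC g hg
      rw [← Subgroup.card_mul_index ((Subgroup.zpowers g).subgroupOf (Subgroup.centralizer {g})),
        Nat.card_congr (Subgroup.subgroupOfEquivOfLe (zpowers_le_centralizer_singleton g)).toEquiv,
        Nat.card_zpowers, mul_comm] at this
      exact Nat.le_of_mul_le_mul_right this (orderOf_pos g)
    calc Nat.card E ≤ 2 ^ k * 2 := h1 ▸ Nat.mul_le_mul h3 h2
      _ = 2 ^ (k + 1) := (pow_succ _ _).symm
      _ ≤ 2 ^ (2 * k + 2) := Nat.pow_le_pow_right two_pos (by omega)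

/-! ### Square roots of one modulo powers of two, and conjugation -/

section Arithmetic

theorem two_pow_dvd_sub_one_of_sq {s : ℤ} {t : ℕ} (hs : s % 4 = 1)
    (h : (2 : ℤ) ^ (t + 1) ∣ s ^ 2 - 1) : (2 : ℤ) ^ t ∣ s - 1 := by
  obtain ⟨w, hw⟩ : ∃ w, s + 1 = 2 * (2 * w + 1) := ⟨s / 4, by omega⟩
  have h1 : (2 : ℤ) * 2 ^ t ∣ 2 * ((s - 1) * (2 * w + 1)) := by
    have : s ^ 2 - 1 = 2 * ((s - 1) * (2 * w + 1)) := by linear_combination (s - 1) * hw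
    rw [← this, ← pow_succ']
    exact h
  have h2 := (mul_dvd_mul_iff_left (two_ne_zero (α := ℤ))).1 h1
  refine IsCoprime.dvd_of_dvd_mul_right ?_ h2
  exact IsCoprime.pow_left ⟨-w, 1, by ring⟩

theorem two_pow_dvd_add_one_of_sq {s : ℤ} {t : ℕ} (hs : s % 4 = 3)
    (h : (2 : ℤ) ^ (t + 1) ∣ s ^ 2 - 1) : (2 : ℤ) ^ t ∣ s + 1 := by
  have := two_pow_dvd_sub_one_of_sq (s := -s) (t := t) (by omega) (by simpa using h)
  rw [show s + 1 = -(-s - 1) by ring]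
  exact (dvd_neg).2 this

/-- A square root of `1` modulo `2 ^ n` that is `-1` modulo `4` is `-1` or `-1 + 2 ^ (n - 1)`. -/
theorem exists_standard_exponent {s : ℤ} {n : ℕ} (hn : 1 ≤ n) (hs : s % 4 = 3)
    (h : (2 : ℤ) ^ n ∣ s ^ 2 - 1) :
    ∃ r : ℤ, (r = -1 ∨ r = -1 + 2 ^ (n - 1)) ∧ (2 : ℤ) ^ n ∣ r - s := by
  obtain ⟨n, rfl⟩ := Nat.exists_eq_add_of_le' hn
  obtain ⟨q, hq⟩ := two_pow_dvd_add_one_of_sq hs h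
  rw [Nat.add_sub_cancel]
  rcases Int.even_or_odd' q with ⟨l, rfl | rfl⟩
  · exact ⟨-1, Or.inl rfl, -l, by rw [pow_succ]; linear_combination -hq⟩
  · exact ⟨-1 + 2 ^ n, Or.inr rfl, -l, by rw [pow_succ]; linear_combination -hq⟩

end Arithmetic

section Conjugation

variable {G : Type*} [Group G]

theorem inv_conj_mul (g x y : G) : g⁻¹ * (x * y) * g = g⁻¹ * x * g * (g⁻¹ * y * g) := by
  group

theorem inv_conj_zpow (g x : G) (i : ℤ) : g⁻¹ * x ^ i * g = (g⁻¹ * x * g) ^ i := by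
  have := (conj_zpow (a := g⁻¹) (b := x) (i := i))
  rw [inv_inv] at this
  exact this.symm

theorem inv_conj_eq_self_iff {g x : G} : g⁻¹ * x * g = x ↔ g * x = x * g := by
  rw [mul_assoc, inv_mul_eq_iff_eq_mul]
  exact eq_comm

theorem zpow_eq_zpow_of_dvd {x : G} {N : ℕ} {i j : ℤ} (hx : x ^ N = 1)
    (h : (N : ℤ) ∣ i - j) : x ^ i = x ^ j := by
  rw [← mul_inv_eq_one, ← zpow_sub]
  exact orderOf_dvd_iff_zpow_eq_one.1
    ((Int.natCast_dvd_natCast.2 (orderOf_dvd_of_pow_eq_one hx)).trans h)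

theorem exists_inv_conj_eq_zpow {x : G} (hx : (Subgroup.zpowers x).Normal) (g : G) :
    ∃ r : ℤ, g⁻¹ * x * g = x ^ r := by
  obtain ⟨r, hr⟩ := hx.conj_mem x (Subgroup.mem_zpowers x) g⁻¹
  exact ⟨r, by simpa using hr.symm⟩

theorem orderOf_mul_orderOf_le_card_centralizer [Finite G] {v h : G} (hv : h * v = v * h)
    (hd : Subgroup.zpowers v ⊓ Subgroup.zpowers h = ⊥) :
    orderOf v * orderOf h ≤ Nat.card (Subgroup.centralizer {h}) := by
  have hvC : Subgroup.zpowers v ≤ Subgroup.centralizer {h} := by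
    rw [Subgroup.zpowers_le, Subgroup.mem_centralizer_singleton_iff]
    exact hv.symm
  have hhC := zpowers_le_centralizer_singleton h
  rw [← Nat.card_zpowers v, ← Nat.card_zpowers h, ← Nat.card_prod]
  refine Nat.card_le_card_of_injective
    (fun p : Subgroup.zpowers v × Subgroup.zpowers h =>
      (⟨p.1 * p.2, mul_mem (hvC p.1.2) (hhC p.2.2)⟩ : Subgroup.centralizer {h})) ?_
  intro p q hpq
  exact Subgroup.mul_injective_of_disjoint (disjoint_iff.2 hd) (congrArg Subtype.val hpq)

end Conjugation

/-! ### The action on an abelian subgroup of large exponent -/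

/-- A self-centralizing normal abelian subgroup `A = ⟨a⟩ × B` of exponent `2 ^ n = |a|` in a group
in which `|C_G(g) : ⟨g⟩| ≤ 2 ^ k` whenever `⟨g⟩` is not normal, where `n` is large with respect
to `k`. The last two fields are the consequences of that bound for `A`: the elements of small
order generate normal subgroups, and either all elements do, or `|B| ≤ 2 ^ k`. -/
structure IsLargeSplitting {G : Type*} [Group G] (A B : Subgroup G) (a : G) (n k : ℕ) : Prop where
  normal : A.Normal
  comm : ∀ x ∈ A, ∀ y ∈ A, x * y = y * x
  self : ∀ g : G, (∀ x ∈ A, g * x = x * g) → g ∈ A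
  sup : Subgroup.zpowers a ⊔ B = A
  inf : Subgroup.zpowers a ⊓ B = ⊥
  order : orderOf a = 2 ^ n
  exp : ∀ x ∈ A, x ^ 2 ^ n = 1
  cent : ∀ g : G, ¬ (Subgroup.zpowers g).Normal →
    Nat.card (Subgroup.centralizer {g}) ≤ 2 ^ k * orderOf g
  large : 3 * k + 5 ≤ n
  small : ∀ x ∈ A, x ^ 2 ^ (n - k - 1) = 1 → (Subgroup.zpowers x).Normal
  alt : (∀ x ∈ A, (Subgroup.zpowers x).Normal) ∨ Nat.card B ∣ 2 ^ k

/-- `g` raises the elements of `A` of order dividing `2 ^ t` to the power `s`. -/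
def ActsAsPower {G : Type*} [Group G] (A : Subgroup G) (t : ℕ) (g : G) (s : ℤ) : Prop :=
  ∀ x ∈ A, x ^ 2 ^ t = 1 → g⁻¹ * x * g = x ^ s

theorem ActsAsPower.mono {G : Type*} [Group G] {A : Subgroup G} {t u : ℕ} {g : G} {s : ℤ}
    (h : ActsAsPower A t g s) (hu : u ≤ t) : ActsAsPower A u g s := by
  intro x hx hxu
  refine h x hx ?_
  rw [← Nat.add_sub_cancel' hu, pow_add, pow_mul, hxu, one_pow]

theorem ActsAsPower.mul {G : Type*} [Group G] {A : Subgroup G} {t : ℕ} {g h : G} {r s : ℤ}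
    (hg : ActsAsPower A t g r) (hh : ActsAsPower A t h s) : ActsAsPower A t (g * h) (s * r) := by
  intro x hx hxt
  have : (g * h)⁻¹ * x * (g * h) = h⁻¹ * (g⁻¹ * x * g) * h := by group
  rw [this, hg x hx hxt, inv_conj_zpow, hh x hx hxt, zpow_mul]

namespace IsLargeSplitting

variable {G : Type*} [Group G] {A B : Subgroup G} {a : G} {n k : ℕ}

theorem mem (h : IsLargeSplitting A B a n k) : a ∈ A :=
  h.sup ▸ Subgroup.mem_sup_left (Subgroup.mem_zpowers a)

theorem le (h : IsLargeSplitting A B a n k) : B ≤ A :=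
  h.sup ▸ le_sup_right

theorem exists_decomp (h : IsLargeSplitting A B a n k) {x : G} (hx : x ∈ A) :
    ∃ i : ℤ, ∃ c ∈ B, x = a ^ i * c := by
  have hx' : (⟨x, hx⟩ : A) ∈ (Subgroup.zpowers a).subgroupOf A ⊔ B.subgroupOf A := by
    rw [← Subgroup.subgroupOf_sup (h.sup ▸ le_sup_left) h.le, h.sup]
    simp
  have hn : (B.subgroupOf A).Normal :=
    ⟨fun y hy g => by
      have : g * y * g⁻¹ = y := by
        rw [mul_inv_eq_iff_eq_mul]
        exact Subtype.ext (h.comm _ g.2 _ y.2)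
      rwa [this]⟩
  obtain ⟨y, hy, c, hc, hyc⟩ := Subgroup.mem_sup_of_normal_right.1 hx'
  obtain ⟨i, hi⟩ := hy
  refine ⟨i, c, hc, ?_⟩
  have := congrArg Subtype.val hyc
  simp only [Subgroup.coe_mul] at this
  rw [← this]
  congr 1
  exact hi.symm

theorem zpow_eq_one_iff (h : IsLargeSplitting A B a n k) {i : ℤ} :
    a ^ i = 1 ↔ (2 : ℤ) ^ n ∣ i := by
  rw [← orderOf_dvd_iff_zpow_eq_one, h.order]
  norm_num

theorem eq_one_of_mem (h : IsLargeSplitting A B a n k) {x : G} (hx : x ∈ Subgroup.zpowers a)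
    (hx' : x ∈ B) : x = 1 := by
  have : x ∈ Subgroup.zpowers a ⊓ B := ⟨hx, hx'⟩
  rwa [h.inf, Subgroup.mem_bot] at this

theorem generator_zpow_mem (h : IsLargeSplitting A B a n k) (i : ℤ) : a ^ i ∈ A :=
  A.zpow_mem h.mem i

/-- Uniqueness of the decomposition `A = ⟨a⟩ × B`. -/
theorem decomp_unique (h : IsLargeSplitting A B a n k) {i j : ℤ} {c d : G} (hc : c ∈ B)
    (hd : d ∈ B) (he : a ^ i * c = a ^ j * d) : (2 : ℤ) ^ n ∣ i - j ∧ c = d := by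
  have h1 : a ^ (i - j) = d * c⁻¹ := by
    rw [sub_eq_neg_add, zpow_add, eq_mul_inv_iff_mul_eq, mul_assoc, he, ← mul_assoc, ← zpow_add]
    simp
  have h2 : a ^ (i - j) = 1 :=
    h.eq_one_of_mem ⟨_, rfl⟩ (h1 ▸ B.mul_mem hd (B.inv_mem hc))
  refine ⟨h.zpow_eq_one_iff.1 h2, ?_⟩
  rw [h2, eq_mul_inv_iff_mul_eq, one_mul] at h1
  exact h1

theorem mul_zpow (h : IsLargeSplitting A B a n k) {x y : G} (hx : x ∈ A) (hy : y ∈ A) (i : ℤ) :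
    (x * y) ^ i = x ^ i * y ^ i :=
  Commute.mul_zpow (h.comm x hx y hy) i

theorem inv_conj_mem (h : IsLargeSplitting A B a n k) {x : G} (hx : x ∈ A) (g : G) :
    g⁻¹ * x * g ∈ A := by
  simpa using h.normal.conj_mem x hx g⁻¹

/-- If the elements of `A` of order dividing `2 ^ t` generate normal subgroups, then every group
element acts on all of them as one and the same power. -/
theorem exists_actsAsPower (h : IsLargeSplitting A B a n k) {t : ℕ} (ht : t ≤ n)
    (hnorm : ∀ x ∈ A, x ^ 2 ^ t = 1 → (Subgroup.zpowers x).Normal) (g : G) :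
    ∃ s : ℤ, ActsAsPower A t g s := by
  set e : ℤ := 2 ^ (n - t) with he
  have het : e * 2 ^ t = 2 ^ n := by rw [he, ← pow_add]; congr 1; omega
  have hupow : ∀ i : ℤ, (a ^ e) ^ i = 1 → (2 : ℤ) ^ t ∣ i := by
    intro i hi
    rw [← zpow_mul, h.zpow_eq_one_iff, ← het] at hi
    exact (mul_dvd_mul_iff_left (by positivity)).1 hi
  have hu : (a ^ e) ^ 2 ^ t = 1 := by
    have : (a ^ e) ^ 2 ^ t = a ^ (e * 2 ^ t) := by
      rw [zpow_mul]; norm_cast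
    rw [this, het, h.zpow_eq_one_iff]
  obtain ⟨s, hs⟩ := exists_inv_conj_eq_zpow (hnorm _ (h.generator_zpow_mem e) hu) g
  refine ⟨s, fun x hx hxt => ?_⟩
  obtain ⟨i, c, hc, rfl⟩ := h.exists_decomp hx
  have hcA := h.le hc
  have hsplit : (2 : ℤ) ^ n ∣ i * 2 ^ t - 0 ∧ c ^ (2 ^ t : ℤ) = 1 := by
    refine h.decomp_unique (B.zpow_mem hc _) B.one_mem ?_
    have h1 : (a ^ i * c) ^ (2 ^ t : ℤ) = 1 := by exact_mod_cast hxt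
    rw [h.mul_zpow (h.generator_zpow_mem i) hcA, ← zpow_mul] at h1
    simpa using h1
  obtain ⟨hi, hct⟩ := hsplit
  have hct' : c ^ 2 ^ t = 1 := by exact_mod_cast hct
  obtain ⟨j, rfl⟩ : e ∣ i := by
    rw [sub_zero, ← het] at hi
    exact (mul_dvd_mul_iff_right (by positivity)).1 hi
  obtain ⟨r, hr⟩ := exists_inv_conj_eq_zpow (hnorm c hcA hct') g
  obtain ⟨q, hq⟩ := exists_inv_conj_eq_zpow (hnorm (a ^ e * c)
    (A.mul_mem (h.generator_zpow_mem e) hcA)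
    (by rw [Commute.mul_pow (h.comm _ (h.generator_zpow_mem e) _ hcA), hu, hct', one_mul])) g
  rw [inv_conj_mul, hs, hr, h.mul_zpow (h.generator_zpow_mem e) hcA, ← zpow_mul, ← zpow_mul] at hq
  obtain ⟨h1, h2⟩ := h.decomp_unique (B.zpow_mem hc _) (B.zpow_mem hc _) hq
  have h3 : (2 : ℤ) ^ t ∣ q - s := by
    apply hupow
    rw [← zpow_mul, h.zpow_eq_one_iff]
    rw [← dvd_neg, show -(e * (q - s)) = e * s - e * q by ring]
    exact h1
  have h4 : c ^ q = c ^ s := zpow_eq_zpow_of_dvd hct' (by exact_mod_cast h3)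
  rw [inv_conj_mul, h.mul_zpow (h.generator_zpow_mem _) hcA, hr, h2, h4, zpow_mul,
    inv_conj_zpow, hs]
  simp only [← zpow_mul]
  rw [mul_right_comm, mul_assoc]

/-- `a ^ 2 ^ (n - t)` generates the subgroup of order `2 ^ t` of `⟨a⟩`. -/
theorem orderOf_generator (h : IsLargeSplitting A B a n k) {t : ℕ} (ht : t ≤ n) :
    orderOf (a ^ 2 ^ (n - t)) = 2 ^ t := by
  rw [orderOf_pow' _ (by positivity), h.order, Nat.gcd_eq_right (pow_dvd_pow 2 (by omega)),
    Nat.pow_div (by omega) two_pos]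
  congr 1
  omega

theorem odd_of_actsAsPower (h : IsLargeSplitting A B a n k) {t : ℕ} (ht1 : 1 ≤ t) (ht : t ≤ n)
    {g : G} {s : ℤ} (hs : ActsAsPower A t g s) : s % 2 = 1 := by
  have ho := h.orderOf_generator (t := 1) (ht1.trans ht)
  set v := a ^ 2 ^ (n - 1)
  obtain hs0 | hs1 := Int.emod_two_eq_zero_or_one s
  · exfalso
    have h2 : v ^ 2 = 1 := by simpa [ho] using pow_orderOf_eq_one v
    have h1 := hs.mono ht1 v (A.pow_mem h.mem _) (by simpa using h2)
    have h3 : v ^ s = v ^ (0 : ℤ) := zpow_eq_zpow_of_dvd h2 (by push_cast; omega)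
    rw [h3, zpow_zero] at h1
    have h4 : v = 1 := by
      have : v = g * (g⁻¹ * v * g) * g⁻¹ := by group
      rw [this, h1]; group
    rw [h4, orderOf_one] at ho
    omega
  · exact hs1

theorem two_pow_dvd_sq_sub_one (h : IsLargeSplitting A B a n k) {t : ℕ} (ht : t ≤ n)
    {g : G} {s : ℤ} (hg : g ^ 2 ∈ A) (hs : ActsAsPower A t g s) : (2 : ℤ) ^ t ∣ s ^ 2 - 1 := by
  have ho := h.orderOf_generator ht
  set v := a ^ 2 ^ (n - t)
  have hv : v ∈ A := A.pow_mem h.mem _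
  have h1 := (hs.mul hs) v hv (by rw [← ho]; exact pow_orderOf_eq_one v)
  rw [inv_conj_eq_self_iff.2 (by rw [← sq]; exact h.comm _ hg _ hv)] at h1
  have h2 : v ^ (s ^ 2 - 1) = 1 := by
    rw [zpow_sub, sq, ← h1]; simp
  have := orderOf_dvd_iff_zpow_eq_one.2 h2
  rw [ho] at this
  exact_mod_cast this

end IsLargeSplitting

/-! ### Elements acting as a power congruent to one modulo four -/

namespace IsLargeSplitting

variable {G : Type*} [Group G] {A B : Subgroup G} {a : G} {n k : ℕ}

/-- Up to multiplication by an element of `A`, the square of `g` lies in `B`, provided that the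
`⟨a⟩`-component of `g ^ 2` is a square in `⟨a⟩`. -/
theorem exists_mul_sq_mem (h : IsLargeSplitting A B a n k) {g : G}
    (hz : ∀ x ∈ A, x ^ 2 ^ (n - k - 2) = 1 → g * x = x * g) {e : ℤ} {c : G} (hc : c ∈ B)
    (hg : g ^ 2 = a ^ (2 * e) * c) : ∃ y ∈ A, (y * g) ^ 2 ∈ B := by
  have hl := h.large
  have hcA := h.le hc
  have hxm := h.generator_zpow_mem (-e)
  set x := a ^ (-e) with hx
  set d := x⁻¹ * (g * x * g⁻¹) with hd
  have hgx : g * x * g⁻¹ ∈ A := h.normal.conj_mem x hxm g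
  have hdA : d ∈ A := A.mul_mem (A.inv_mem hxm) hgx
  have hxpow : x ^ 2 * a ^ (2 * e) = 1 := by
    rw [hx, ← zpow_natCast, ← zpow_mul, ← zpow_add]
    convert zpow_zero a using 2
    push_cast; ring
  -- since `x ^ 2 ^ (k + 2)` commutes with `g`, the order of `d` is at most `2 ^ (k + 2)`
  have hdpow : d ^ 2 ^ (k + 2) = 1 := by
    have h1 : g * x ^ 2 ^ (k + 2) = x ^ 2 ^ (k + 2) * g := by
      refine hz _ (A.pow_mem hxm _) ?_
      rw [← pow_mul, ← pow_add, show k + 2 + (n - k - 2) = n by omega]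
      exact h.exp x hxm
    rw [hd, Commute.mul_pow (h.comm _ (A.inv_mem hxm) _ hgx), conj_pow, h1]
    group
  have hsq : (x * g) ^ 2 = d * c := by
    have h1 : (x * g) ^ 2 = x * (g * x * g⁻¹) * g ^ 2 := by simp [sq, mul_assoc]
    have h2 : g * x * g⁻¹ = d * x := by
      rw [h.comm _ hdA _ hxm, hd]; group
    calc (x * g) ^ 2 = x * (d * x) * (a ^ (2 * e) * c) := by rw [h1, h2, hg]
      _ = d * (x ^ 2 * a ^ (2 * e)) * c := by
        rw [← mul_assoc x d x, h.comm _ hxm _ hdA, sq]; group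
      _ = d * c := by rw [hxpow, mul_one]
  obtain ⟨i, c', hc', hdi⟩ := h.exists_decomp hdA
  have hi : (2 : ℤ) ^ n ∣ i * 2 ^ (k + 2) - 0 := by
    refine (h.decomp_unique (B.pow_mem hc' (2 ^ (k + 2))) B.one_mem ?_).1
    rw [hdi, Commute.mul_pow (h.comm _ (h.generator_zpow_mem i) _ (h.le hc')), ← zpow_natCast,
      ← zpow_mul] at hdpow
    simpa using hdpow
  obtain ⟨l, hl'⟩ : (2 : ℤ) ^ (n - k - 2) ∣ i := by
    rw [sub_zero, show n = (n - k - 2) + (k + 2) by omega, pow_add] at hi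
    exact (mul_dvd_mul_iff_right (by positivity)).1 hi
  set f : ℤ := 2 ^ (n - k - 3) * l with hf
  have hif : i = 2 * f := by
    rw [hl', hf, ← mul_assoc, ← pow_succ']; congr 2; omega
  -- `a ^ f` is a square root of the `⟨a⟩`-component of `d` and has small order
  have hcomm : g * a ^ (-f) = a ^ (-f) * g := by
    refine hz _ (h.generator_zpow_mem _) ?_
    rw [← zpow_natCast, ← zpow_mul, h.zpow_eq_one_iff, hf]
    push_cast
    refine Dvd.intro (-l * 2 ^ (n - k - 3 + (n - k - 2) - n)) ?_
    have : (2 : ℤ) ^ n * 2 ^ (n - k - 3 + (n - k - 2) - n) =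
        2 ^ (n - k - 3) * 2 ^ (n - k - 2) := by
      rw [← pow_add, ← pow_add]; congr 1; omega
    linear_combination (-l) * this
  refine ⟨a ^ (-f) * x, A.mul_mem (h.generator_zpow_mem _) hxm, ?_⟩
  have hcx : Commute (a ^ (-f)) (x * g) :=
    Commute.mul_right (h.comm _ (h.generator_zpow_mem _) _ hxm) hcomm.symm
  rw [mul_assoc, hcx.mul_pow, hsq, hdi, hif, ← zpow_natCast, ← zpow_mul]
  have : a ^ (-f * (2 : ℕ)) * (a ^ (2 * f) * c' * c) = c' * c := by
    rw [← mul_assoc, ← mul_assoc, ← zpow_add, show -f * (2 : ℕ) + 2 * f = 0 by push_cast; ring]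
    simp
  rw [this]
  exact B.mul_mem hc' hc

theorem pow_eq_one_of_card_dvd [Finite G] (hB : Nat.card B ∣ 2 ^ k) {c : G}
    (hc : c ∈ B) : c ^ 2 ^ k = 1 := by
  have h1 : (⟨c, hc⟩ : B) ^ 2 ^ k = 1 :=
    orderOf_dvd_iff_pow_eq_one.1 ((orderOf_dvd_natCard _).trans hB)
  exact congrArg Subtype.val h1

/-- An element whose square has odd `⟨a⟩`-component, hence order `2 ^ n`, and that centralizes
the elements of small order centralizes `A`. -/
theorem mem_of_sq_odd [Finite G] (h : IsLargeSplitting A B a n k) {g : G}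
    (hz : ∀ x ∈ A, x ^ 2 ^ (n - k - 2) = 1 → g * x = x * g) {i : ℤ} {c : G} (hc : c ∈ B)
    (hi : i % 2 = 1) (hg : g ^ 2 = a ^ i * c) : g ∈ A := by
  have hl := h.large
  have hcop : IsCoprime ((2 : ℤ) ^ n) i := IsCoprime.pow_left ⟨-(i / 2), 1, by omega⟩
  have hgc : g * (a ^ i * c) = a ^ i * c * g := by rw [← hg]; group
  refine h.self g ?_
  rcases h.alt with hn | hB
  · obtain ⟨s, hs⟩ := h.exists_actsAsPower le_rfl (fun x hx _ => hn x hx) g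
    have hic : a ^ i * c ∈ A := A.mul_mem (h.generator_zpow_mem i) (h.le hc)
    have h1 := hs _ hic (h.exp _ hic)
    rw [inv_conj_eq_self_iff.2 hgc, h.mul_zpow (h.generator_zpow_mem i) (h.le hc), ← zpow_mul] at h1
    have h2 := (h.decomp_unique hc (B.zpow_mem hc s) h1).1
    have h3 : (2 : ℤ) ^ n ∣ 1 - s := by
      rw [show i - i * s = i * (1 - s) by ring] at h2
      exact hcop.dvd_of_dvd_mul_left h2
    intro x hx
    rw [← inv_conj_eq_self_iff, hs x hx (h.exp x hx)]
    refine (zpow_eq_zpow_of_dvd (h.exp x hx) (j := 1) ?_).trans (zpow_one x)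
    rw [← dvd_neg]
    simpa using h3
  · have hBg : ∀ d ∈ B, g * d = d * g := by
      intro d hd
      refine hz d (h.le hd) ?_
      rw [show n - k - 2 = k + (n - k - 2 - k) by omega, pow_add, pow_mul,
        pow_eq_one_of_card_dvd hB hd, one_pow]
    have h1 : Commute g (a ^ i) := by
      have h2 : Commute g (a ^ i * c) := hgc
      have h3 : Commute g c := hBg c hc
      simpa using h2.mul_right h3.inv_right
    have h4 : Commute g a := by
      obtain ⟨u, v, huv⟩ := hcop
      have : a = (a ^ i) ^ v := by
        rw [← zpow_mul]
        nth_rewrite 1 [← zpow_one a]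
        rw [← huv, zpow_add, h.zpow_eq_one_iff.2 (Dvd.intro_left u rfl), one_mul, mul_comm v i]
      rw [this]
      exact h1.zpow_right v
    intro x hx
    obtain ⟨j, d, hd, rfl⟩ := h.exists_decomp hx
    exact ((h4.zpow_right j).mul_right (hBg d hd) : Commute _ _)

/-- An element whose square lies in `B` and that centralizes the elements of small order
centralizes `A`. -/
theorem mem_of_sq_mem [Finite G] (h : IsLargeSplitting A B a n k) {g : G}
    (hz : ∀ x ∈ A, x ^ 2 ^ (n - k - 2) = 1 → g * x = x * g) (hg : g ^ 2 ∈ B) : g ∈ A := by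
  have hl := h.large
  by_contra hgA
  -- `v` generates the subgroup of order `2 ^ (n - k - 2)` of `⟨a⟩`
  have hvo := h.orderOf_generator (t := n - k - 2) (by omega)
  set v := a ^ 2 ^ (n - (n - k - 2)) with hv
  have hvA : v ∈ A := A.pow_mem h.mem _
  have hva : v ∈ Subgroup.zpowers a := pow_mem (Subgroup.mem_zpowers a) _
  have hgv : g * v = v * g := hz v hvA (by rw [← hvo]; exact pow_orderOf_eq_one v)
  have hparity : ∀ j : ℤ, g ^ j ∈ A → g ^ j ∈ B := by
    intro j hj
    rcases Int.even_or_odd' j with ⟨l, rfl | rfl⟩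
    · rw [zpow_mul]
      exact B.zpow_mem (by exact_mod_cast hg) l
    · exfalso
      rw [zpow_add, zpow_mul, zpow_one] at hj
      exact hgA ((A.mul_mem_cancel_left (A.zpow_mem (by exact_mod_cast h.le hg) l)).1 hj)
  have hdisj : ∀ x ∈ Subgroup.zpowers g, x ∈ Subgroup.zpowers a → x = 1 := by
    rintro _ ⟨j, rfl⟩ hx
    exact h.eq_one_of_mem hx (hparity j (Subgroup.zpowers_le.2 h.mem hx))
  have hnormal : (Subgroup.zpowers g).Normal := by
    by_contra hcon
    have h1 := h.cent g hcon
    have h2 := orderOf_mul_orderOf_le_card_centralizer hgv (by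
      rw [eq_bot_iff]
      rintro x ⟨hx, hx'⟩
      exact hdisj x hx' ((Subgroup.zpowers_le.2 hva) hx))
    have h3 := Nat.le_of_mul_le_mul_right (h2.trans h1) (orderOf_pos g)
    rw [hvo] at h3
    have := (Nat.pow_le_pow_iff_right (by norm_num)).1 h3
    omega
  rcases h.alt with hn | hB
  · obtain ⟨s, hs⟩ := h.exists_actsAsPower le_rfl (fun x hx _ => hn x hx) g
    have h1 : a⁻¹ * (g⁻¹ * a * g) = 1 := by
      refine hdisj _ ?_ ?_
      · rw [show a⁻¹ * (g⁻¹ * a * g) = (a⁻¹ * g⁻¹ * a⁻¹⁻¹) * g by group]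
        exact mul_mem (hnormal.conj_mem _ (inv_mem (Subgroup.mem_zpowers g)) _)
          (Subgroup.mem_zpowers g)
      · rw [hs a h.mem (h.exp a h.mem)]
        exact mul_mem (inv_mem (Subgroup.mem_zpowers a)) (zpow_mem (Subgroup.mem_zpowers a) s)
    have h2 : a ^ (s - 1) = 1 := by
      rw [inv_mul_eq_one, hs a h.mem (h.exp a h.mem)] at h1
      rw [zpow_sub, zpow_one, ← h1, mul_inv_cancel]
    refine hgA (h.self g fun x hx => ?_)
    rw [← inv_conj_eq_self_iff, hs x hx (h.exp x hx)]
    refine (zpow_eq_zpow_of_dvd (h.exp x hx) (j := 1) ?_).trans (zpow_one x)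
    exact_mod_cast h.zpow_eq_one_iff.1 h2
  · have hwo := h.orderOf_generator (t := k + 1) (by omega)
    set w := a ^ 2 ^ (n - (k + 1)) with hw
    have hwA : w ∈ A := A.pow_mem h.mem _
    have hwa : w ∈ Subgroup.zpowers a := pow_mem (Subgroup.mem_zpowers a) _
    have hw1 : w ^ 2 ^ (k + 1) = 1 := by rw [← hwo]; exact pow_orderOf_eq_one w
    have hg1 : g ^ 2 ^ (k + 1) = 1 := by
      rw [pow_succ', pow_mul, pow_eq_one_of_card_dvd hB hg]
    have hgw : Commute g w := by
      refine hz w hwA ?_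
      rw [show n - k - 2 = (k + 1) + (n - k - 2 - (k + 1)) by omega, pow_add, pow_mul, hw1,
        one_pow]
    have hgw1 : (g * w) ^ 2 ^ (k + 1) = 1 := by rw [hgw.mul_pow, hg1, hw1, one_mul]
    -- `g * w` has order at most `2 ^ (k + 1)` and centralizes `v`, of order `2 ^ (n - k - 2)`
    have hnormal' : (Subgroup.zpowers (g * w)).Normal := by
      by_contra hcon
      have h1 := h.cent _ hcon
      have h2 := Nat.mul_le_mul_left (2 ^ k)
        (orderOf_le_of_pow_eq_one (by positivity) hgw1)
      have h3 : orderOf v ≤ Nat.card (Subgroup.centralizer {g * w}) := by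
        rw [← Nat.card_zpowers]
        refine Subgroup.card_le_of_le ?_
        rw [Subgroup.zpowers_le, Subgroup.mem_centralizer_singleton_iff]
        exact ((Commute.mul_left hgv (h.comm _ hwA _ hvA)).symm : Commute _ _)
      have h4 := (h3.trans h1).trans h2
      rw [hvo, ← pow_add] at h4
      have := (Nat.pow_le_pow_iff_right (by norm_num)).1 h4
      omega
    refine hgA (h.self g fun x hx => ?_)
    obtain ⟨p, hp⟩ := hnormal.conj_mem g (Subgroup.mem_zpowers g) x⁻¹
    obtain ⟨q, hq⟩ := hnormal'.conj_mem _ (Subgroup.mem_zpowers (g * w)) x⁻¹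
    simp only [inv_inv] at hp hq
    -- `x⁻¹ g x g⁻¹` is a power both of `g` and of `g w`
    have hxw := h.comm _ hx _ hwA
    have h1 : g ^ (q - 1) * w ^ (q - 1) = g ^ (p - 1) := by
      have h2 : (g * w) ^ q = g ^ p * w := by
        rw [hq, hp, mul_assoc x⁻¹, mul_assoc g, ← hxw]; group
      rw [hgw.mul_zpow] at h2
      rw [zpow_sub_one, zpow_sub_one, zpow_sub_one]
      have h3 := (hgw.inv_left.zpow_right q).eq
      calc g ^ q * g⁻¹ * (w ^ q * w⁻¹) = g ^ q * (g⁻¹ * w ^ q) * w⁻¹ := by group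
        _ = (g ^ q * w ^ q) * (g⁻¹ * w⁻¹) := by rw [h3]; group
        _ = g ^ p * (w * g⁻¹ * w⁻¹) := by rw [h2]; group
        _ = g ^ p * g⁻¹ := by rw [← hgw.inv_left.eq]; group
    have h2 : w ^ (q - 1) = 1 := by
      refine hdisj _ ⟨p - 1 - (q - 1), ?_⟩ (zpow_mem hwa _)
      simp only
      rw [zpow_sub, ← h1, ((Commute.zpow_zpow hgw (q - 1) (q - 1))).eq, mul_inv_cancel_right]
    have h3 : (2 ^ (k + 1) : ℤ) ∣ q - 1 := by
      have := orderOf_dvd_iff_zpow_eq_one.2 h2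
      rw [hwo] at this
      exact_mod_cast this
    have h4 : g ^ (q - 1) = 1 := by
      obtain ⟨r, hr⟩ := h3
      rw [hr, zpow_mul]
      have : g ^ (2 ^ (k + 1) : ℤ) = 1 := by exact_mod_cast hg1
      rw [this, one_zpow]
    rw [h2, h4, one_mul] at h1
    have h5 : g ^ p = g := by
      rw [zpow_sub_one] at h1
      exact (mul_inv_eq_one.1 h1.symm)
    rw [h5] at hp
    have : g * x = x * (x⁻¹ * g * x) := by group
    rw [this, ← hp]

/-- An element that acts on the elements of small order as a power congruent to `1` modulo `4`
lies in `A`. -/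
theorem mem_of_actsAsPower_one [Finite G] (h : IsLargeSplitting A B a n k) (hG : IsPGroup 2 G)
    {g : G} {s : ℤ} (hs : ActsAsPower A (n - k - 1) g s) (hs4 : s % 4 = 1) : g ∈ A := by
  have hl := h.large
  have key : ∀ (j : ℕ) (g : G) (s : ℤ), ActsAsPower A (n - k - 1) g s → s % 4 = 1 →
      g ^ 2 ^ j ∈ A → g ∈ A := by
    intro j
    induction j with
    | zero => intro g s _ _ hg; simpa using hg
    | succ j ih =>
      intro g s hs hs4 hg
      have hg2 : g ^ 2 ∈ A := by
        refine ih (g ^ 2) (s * s) (sq g ▸ hs.mul hs) (by rw [Int.mul_emod, hs4]; rfl) ?_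
        rwa [← pow_mul, ← pow_succ']
      have h1 := h.two_pow_dvd_sq_sub_one (by omega) hg2 hs
      rw [show n - k - 1 = n - k - 2 + 1 by omega] at h1
      have h2 := two_pow_dvd_sub_one_of_sq hs4 h1
      have hz : ∀ x ∈ A, x ^ 2 ^ (n - k - 2) = 1 → g * x = x * g := by
        intro x hx hx1
        rw [← inv_conj_eq_self_iff, hs.mono (by omega) x hx hx1]
        refine (zpow_eq_zpow_of_dvd hx1 (j := 1) ?_).trans (zpow_one x)
        exact_mod_cast h2
      obtain ⟨i, c, hc, hgi⟩ := h.exists_decomp hg2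
      rcases Int.even_or_odd' i with ⟨e, rfl | rfl⟩
      · obtain ⟨y, hy, hyB⟩ := h.exists_mul_sq_mem hz hc hgi
        refine (A.mul_mem_cancel_left hy).1 (h.mem_of_sq_mem ?_ hyB)
        intro x hx hx1
        exact (Commute.mul_left (h.comm _ hy _ hx) (hz x hx hx1) : Commute _ _)
      · exact h.mem_of_sq_odd hz hc (by omega) hgi
  obtain ⟨j, hj⟩ := hG g
  exact key j g s hs hs4 (hj ▸ A.one_mem)

end IsLargeSplitting

/-! ### Membership in the families -/

namespace IsLargeSplitting

variable {G : Type*} [Group G] [Finite G] {A B : Subgroup G} {a : G} {n k : ℕ}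

theorem emod_four_of_actsAsPower (h : IsLargeSplitting A B a n k) (hG : IsPGroup 2 G)
    {g : G} {s : ℤ} (hs : ActsAsPower A (n - k - 1) g s) (hg : g ∉ A) : s % 4 = 3 := by
  have hl := h.large
  have h1 := h.odd_of_actsAsPower (by omega) (by omega) hs
  have h2 : s % 4 ≠ 1 := fun h2 => hg (h.mem_of_actsAsPower_one hG hs h2)
  omega

/-- `A` has index at most two in `G`. -/
theorem mul_mem_of_notMem (h : IsLargeSplitting A B a n k) (hG : IsPGroup 2 G)
    {b g : G} (hb : b ∉ A) (hg : g ∉ A) : g * b ∈ A := by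
  obtain ⟨s, hs⟩ := h.exists_actsAsPower (Nat.sub_le (n - k) 1 |>.trans (Nat.sub_le n k)) h.small b
  obtain ⟨r, hr⟩ := h.exists_actsAsPower (Nat.sub_le (n - k) 1 |>.trans (Nat.sub_le n k)) h.small g
  refine h.mem_of_actsAsPower_one hG (hr.mul hs) ?_
  rw [Int.mul_emod, h.emod_four_of_actsAsPower hG hs hb, h.emod_four_of_actsAsPower hG hr hg]
  rfl

theorem isBasicExtension (h : IsLargeSplitting A B a n k) (hG : IsPGroup 2 G)
    {b : G} (hb : b ∉ A) : IsBasicExtension A b := by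
  have hl := h.large
  refine ⟨h.normal, h.comm, ?_, ?_⟩
  · rw [Subgroup.eq_top_iff']
    intro g
    by_cases hg : g ∈ A
    · exact Subgroup.subset_closure (Or.inr hg)
    · have h1 : g = (g * b) * b⁻¹ := by group
      rw [h1]
      exact Subgroup.mul_mem _
        (Subgroup.subset_closure (Or.inr (h.mul_mem_of_notMem hG hb hg)))
        (Subgroup.inv_mem _ (Subgroup.subset_closure (Or.inl rfl)))
  · have hb2 : b ^ 2 ∈ A := sq b ▸ h.mul_mem_of_notMem hG hb hb
    refine Subgroup.subset_closure ⟨hb2, ?_⟩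
    obtain ⟨s, hs⟩ := h.exists_actsAsPower (t := n - k - 1) (by omega) h.small b
    have hs4 := h.emod_four_of_actsAsPower hG hs hb
    -- otherwise some power of `b ^ 2` has order four, and `b` centralizes and inverts it
    have key : ∀ j : ℕ, (b ^ 2) ^ 2 ^ (j + 1) = 1 → (b ^ 2) ^ 2 = 1 := by
      intro j
      induction j with
      | zero => intro h1; simpa using h1
      | succ j ih =>
        intro h1
        refine ih ?_
        set y := (b ^ 2) ^ 2 ^ j with hy
        have hy4 : y ^ 4 = 1 := by
          rw [hy, ← pow_mul]; rw [← h1]; congr 1; ring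
        have hyA : y ∈ A := A.pow_mem hb2 _
        have hyb : b * y = y * b := ((Commute.refl b).pow_right 2).pow_right _
        have h2 := hs y hyA (by
          rw [show n - k - 1 = 2 + (n - k - 1 - 2) by omega, pow_add, pow_mul,
            show y ^ 2 ^ 2 = 1 from hy4, one_pow])
        rw [inv_conj_eq_self_iff.2 hyb] at h2
        have h3 : y ^ s = y ^ (3 : ℤ) := zpow_eq_zpow_of_dvd hy4 (by push_cast; omega)
        have h4 : y ^ 2 = 1 := by
          have h5 : y * y ^ 2 = y * 1 := by
            rw [mul_one, ← pow_succ']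
            rw [h3] at h2
            exact_mod_cast h2.symm
          exact mul_left_cancel h5
        rw [pow_succ 2 j, pow_mul]
        exact h4
    obtain ⟨j, hj⟩ := hG (b ^ 2)
    exact key j (by rw [pow_succ 2 j, pow_mul, hj, one_pow])

theorem inFamilyOne (h : IsLargeSplitting A B a n k) (hG : IsPGroup 2 G) {b : G} (hb : b ∉ A)
    (hn : ∀ x ∈ A, (Subgroup.zpowers x).Normal) : InFamilyOne G := by
  have hl := h.large
  have hbasic := h.isBasicExtension hG hb
  obtain ⟨s, hs⟩ := h.exists_actsAsPower le_rfl (fun x hx _ => hn x hx) b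
  have hs4 := h.emod_four_of_actsAsPower hG (hs.mono (by omega)) hb
  have hb2 : b ^ 2 ∈ A := sq b ▸ h.mul_mem_of_notMem hG hb hb
  obtain ⟨r, hr, hrs⟩ := exists_standard_exponent (by omega) hs4
    (h.two_pow_dvd_sq_sub_one le_rfl hb2 hs)
  refine ⟨inferInstance, hG, A, b, n, r, hbasic, ?_, ?_, ?_⟩
  · refine Nat.dvd_antisymm ?_ ?_
    · exact Monoid.exponent_dvd_of_forall_pow_eq_one fun x => Subtype.ext (h.exp x x.2)
    · have := Monoid.order_dvd_exponent (⟨a, h.mem⟩ : A)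
      rwa [Subgroup.orderOf_mk, h.order] at this
  · rcases hr with rfl | rfl
    · exact Or.inl ⟨rfl, by omega⟩
    · exact Or.inr ⟨rfl, by omega⟩
  · intro x hx
    rw [hs x hx (h.exp x hx)]
    exact (zpow_eq_zpow_of_dvd (h.exp x hx) (by exact_mod_cast hrs)).symm

theorem inFamilyTwo (h : IsLargeSplitting A B a n k) (hG : IsPGroup 2 G) {b : G} (hb : b ∉ A)
    (hn : ¬ ∀ x ∈ A, (Subgroup.zpowers x).Normal) : InFamilyTwo G := by
  have hl := h.large
  have hbasic := h.isBasicExtension hG hb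
  have hB := h.alt.resolve_left hn
  obtain ⟨m, hmk, hm⟩ := (Nat.dvd_prime_pow Nat.prime_two).1 hB
  obtain ⟨s, hs⟩ := h.exists_actsAsPower (t := n - k - 1) (by omega) h.small b
  have hs4 := h.emod_four_of_actsAsPower hG hs hb
  have hb2 : b ^ 2 ∈ A := sq b ▸ h.mul_mem_of_notMem hG hb hb
  have hBt : ∀ c ∈ B, c ^ 2 ^ (n - k - 1) = 1 := by
    intro c hc
    rw [show n - k - 1 = k + (n - k - 1 - k) by omega, pow_add, pow_mul,
      pow_eq_one_of_card_dvd hB hc, one_pow]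
  have hBs : ∀ c ∈ B, b⁻¹ * c * b = c ^ s := fun c hc => hs c (h.le hc) (hBt c hc)
  obtain ⟨i, z, hz, hab⟩ := h.exists_decomp (h.inv_conj_mem h.mem b)
  have hzA := h.le hz
  -- the exponents on `⟨a⟩` and on `B` agree
  have his : (2 : ℤ) ^ (n - k - 1) ∣ i - s := by
    have hvo := h.orderOf_generator (t := n - k - 1) (by omega)
    set e := 2 ^ (n - (n - k - 1)) with he
    have h1 := hs (a ^ e) (A.pow_mem h.mem _) (by rw [← hvo]; exact pow_orderOf_eq_one _)
    have h2 : a ^ (i * e) * z ^ (e : ℤ) = a ^ (e * s) * 1 := by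
      rw [← zpow_natCast, inv_conj_zpow, hab, h.mul_zpow (h.generator_zpow_mem i) hzA,
        ← zpow_mul, ← zpow_mul] at h1
      rw [h1, mul_one]
    have h3 := (h.decomp_unique (B.zpow_mem hz _) B.one_mem h2).1
    have h4 : (2 : ℤ) ^ (n - k - 1) * e = 2 ^ n := by
      rw [he]; push_cast; rw [← pow_add]; congr 1; omega
    rw [← h4, show i * e - e * s = (i - s) * e by ring] at h3
    exact (mul_dvd_mul_iff_right (by rw [he]; positivity)).1 h3
  have hBi : ∀ c ∈ B, b⁻¹ * c * b = c ^ i := by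
    intro c hc
    rw [hBs c hc]
    exact (zpow_eq_zpow_of_dvd (hBt c hc) (by exact_mod_cast his)).symm
  have hi4 : i % 4 = 3 := by
    have : (4 : ℤ) ∣ i - s :=
      (show (4 : ℤ) = 2 ^ 2 by norm_num) ▸ (pow_dvd_pow 2 (by omega)).trans his
    omega
  -- `b ^ 2` centralizes `a`
  have hsq : a ^ (1 : ℤ) * 1 = a ^ (i * i) * z ^ (i + i) := by
    have h1 : b⁻¹ * (b⁻¹ * a * b) * b = a := by
      have : b⁻¹ * (b⁻¹ * a * b) * b = (b ^ 2)⁻¹ * a * b ^ 2 := by simp [sq, mul_assoc]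
      rw [this]
      exact inv_conj_eq_self_iff.2 (h.comm _ hb2 _ h.mem)
    rw [hab, inv_conj_mul, inv_conj_zpow, hab, hBi z hz,
      h.mul_zpow (h.generator_zpow_mem i) hzA, ← zpow_mul, mul_assoc, ← zpow_add] at h1
    rw [h1]; simp
  obtain ⟨hi1, hz1⟩ := h.decomp_unique B.one_mem (B.zpow_mem hz _) hsq
  have hz2 : z ^ 2 = 1 := by
    have h1 : orderOf (z ^ 2) ∣ 2 ^ k := orderOf_dvd_of_pow_eq_one
      (pow_eq_one_of_card_dvd hB (B.pow_mem hz 2))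
    have h2 : (orderOf (z ^ 2) : ℤ) ∣ i := by
      rw [orderOf_dvd_iff_zpow_eq_one, ← zpow_natCast, ← zpow_mul, hz1]
      congr 1
      push_cast; ring
    have h3 : IsCoprime ((2 : ℤ) ^ k) i := IsCoprime.pow_left ⟨-(i / 2), 1, by omega⟩
    have h4 : IsUnit (orderOf (z ^ 2) : ℤ) :=
      h3.isUnit_of_dvd' (by exact_mod_cast h1) h2
    rw [Int.isUnit_iff] at h4
    exact orderOf_eq_one_iff.1 (by omega)
  obtain ⟨r, hr, hri⟩ := exists_standard_exponent (n := n) (by omega) hi4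
    (by rw [← dvd_neg, show -(i ^ 2 - 1) = 1 - i * i by ring]; exact hi1)
  have har : b⁻¹ * a * b = a ^ r * z := by
    rw [hab]
    congr 1
    exact (zpow_eq_zpow_of_dvd (h.exp a h.mem) (by exact_mod_cast hri)).symm
  have hBr : ∀ c ∈ B, b⁻¹ * c * b = c ^ r := by
    intro c hc
    rw [hBi c hc]
    exact (zpow_eq_zpow_of_dvd (h.exp c (h.le hc)) (by exact_mod_cast hri)).symm
  have hz_ne : z ≠ 1 := by
    rintro rfl
    -- otherwise `b` acts on `A` as a power
    refine hn fun x hx => ?_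
    have hbx : b⁻¹ * x * b = x ^ r := by
      obtain ⟨j, c, hc, rfl⟩ := h.exists_decomp hx
      rw [inv_conj_mul, inv_conj_zpow, har, hBr c hc, mul_one,
        h.mul_zpow (h.generator_zpow_mem j) (h.le hc), ← zpow_mul, ← zpow_mul, mul_comm r j]
    have hgx : ∀ g : G, g * x * g⁻¹ ∈ Subgroup.zpowers x := by
      intro g
      by_cases hg : g ∈ A
      · rw [h.comm g hg x hx, mul_inv_cancel_right]
        exact Subgroup.mem_zpowers x
      · have hy := h.mul_mem_of_notMem hG hb hg
        have h1 : g * x * g⁻¹ = (g * b) * (b⁻¹ * x * b) * (g * b)⁻¹ := by group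
        rw [h1, hbx, h.comm _ hy _ (A.zpow_mem hx r), mul_inv_cancel_right]
        exact zpow_mem (Subgroup.mem_zpowers x) r
    refine ⟨fun y hy g => ?_⟩
    obtain ⟨j, rfl⟩ := hy
    simp only
    rw [← conj_zpow]
    exact zpow_mem (hgx g) j
  refine ⟨inferInstance, hG, A, B, a, z, b, n, m, r, hbasic, h.sup, h.inf, h.order, hm, ?_,
    Subgroup.subset_closure ⟨hz, hz2⟩, hz_ne, ?_, har, hBr⟩
  · rintro rfl
    exact hz_ne (Subgroup.mem_bot.1 hz)
  · rcases hr with rfl | rfl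
    · exact Or.inl ⟨rfl, by omega⟩
    · exact Or.inr ⟨rfl, by omega, by omega⟩

end IsLargeSplitting

/-- The bounds on `|C_G(g) : ⟨g⟩|` force membership in the two families once a self-centralizing
normal abelian subgroup has large exponent. -/
theorem inFamily_of_large_exponent {G : Type*} [Group G] [Finite G] (hG : IsPGroup 2 G)
    (hnd : ¬ IsDedekindGroup G) {k n : ℕ}
    (hC : ∀ g : G, ¬ (Subgroup.zpowers g).Normal →
      Nat.card (Subgroup.centralizer {g}) ≤ 2 ^ k * orderOf g)
    (A : Subgroup G) (hN : A.Normal) (hc : ∀ x ∈ A, ∀ y ∈ A, x * y = y * x)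
    (hself : ∀ g : G, (∀ x ∈ A, g * x = x * g) → g ∈ A)
    (hexp : Monoid.exponent A = 2 ^ n) (hn : 3 * k + 5 ≤ n) :
    InFamilyOne G ∨ InFamilyTwo G := by
  let _ : CommGroup A :=
    { (inferInstance : Group A) with
      mul_comm := fun x y => Subtype.ext (hc x x.2 y y.2) }
  obtain ⟨a, ha⟩ := Monoid.exists_orderOf_eq_exponent
    (Monoid.ExponentExists.of_finite (G := A))
  have hexp' : ∀ x : A, x ^ orderOf a = 1 := fun x => ha ▸ Monoid.pow_exponent_eq_one x
  obtain ⟨B, hsup, hinf⟩ := exists_complement_zpowers a hexp'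
  have hcardA : Nat.card A = 2 ^ n * Nat.card B := by
    have h1 : Subgroup.IsComplement' (Subgroup.zpowers a) B :=
      Subgroup.isComplement'_of_disjoint_and_mul_eq_univ (disjoint_iff.2 hinf) (by
        rw [← Subgroup.normal_mul, hsup, Subgroup.coe_top])
    rw [← h1.card_mul_card, Nat.card_zpowers, ha, hexp]
  have hcentA : ∀ x ∈ A, A ≤ Subgroup.centralizer {x} := by
    intro x hx y hy
    rw [Subgroup.mem_centralizer_singleton_iff]
    exact hc y hy x hx
  have hcardle : ∀ x ∈ A, ¬ (Subgroup.zpowers x).Normal →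
      2 ^ n * Nat.card B ≤ 2 ^ k * orderOf x := by
    intro x hx hxn
    rw [← hcardA]
    exact (Subgroup.card_le_of_le (hcentA x hx)).trans (hC x hxn)
  have hexpA : ∀ x ∈ A, x ^ 2 ^ n = 1 := by
    intro x hx
    have := Monoid.pow_exponent_eq_one (⟨x, hx⟩ : A)
    rw [hexp] at this
    exact congrArg Subtype.val this
  have hL : IsLargeSplitting A (B.map A.subtype) (a : G) n k :=
    { normal := hN
      comm := hc
      self := hself
      sup := by
        have := congrArg (Subgroup.map A.subtype) hsup
        rw [Subgroup.map_sup, MonoidHom.map_zpowers, ← MonoidHom.range_eq_map,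
          Subgroup.range_subtype] at this
        exact this
      inf := by
        have := congrArg (Subgroup.map A.subtype) hinf
        rw [Subgroup.map_inf _ _ _ A.subtype_injective, MonoidHom.map_zpowers] at this
        simpa using this
      order := by rw [Subgroup.orderOf_coe, ha, hexp]
      exp := hexpA
      cent := hC
      large := hn
      small := by
        intro x hx hx1
        by_contra hcon
        have h1 := hcardle x hx hcon
        have h2 := Nat.mul_le_mul_left (2 ^ k) (orderOf_le_of_pow_eq_one (by positivity) hx1)
        have h3 : 2 ^ n ≤ 2 ^ n * Nat.card B := Nat.le_mul_of_pos_right _ Nat.card_pos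
        have h4 := (h3.trans h1).trans h2
        rw [← pow_add] at h4
        have := (Nat.pow_le_pow_iff_right (by norm_num)).1 h4
        omega
      alt := by
        by_cases hall : ∀ x ∈ A, (Subgroup.zpowers x).Normal
        · exact Or.inl hall
        · right
          push Not at hall
          obtain ⟨x, hx, hxn⟩ := hall
          have h1 := hcardle x hx hxn
          have h2 := Nat.mul_le_mul_left (2 ^ k)
            (orderOf_le_of_pow_eq_one (by positivity) (hexpA x hx))
          have h3 : Nat.card B ≤ 2 ^ k := by
            have h4 := h1.trans h2
            rw [mul_comm (2 ^ k)] at h4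
            exact Nat.le_of_mul_le_mul_left h4 (by positivity)
          rw [Subgroup.card_map_of_injective A.subtype_injective]
          obtain ⟨m, hm⟩ := IsPGroup.iff_card.1 ((hG.to_subgroup A).to_subgroup B)
          rw [hm] at h3 ⊢
          exact pow_dvd_pow 2 ((Nat.pow_le_pow_iff_right (by norm_num)).1 h3) }
  obtain ⟨b, hb⟩ : ∃ b, b ∉ A := by
    by_contra hcon
    push Not at hcon
    refine hnd fun H => ⟨fun x hx g => ?_⟩
    rwa [hc g (hcon g) x (hcon x), mul_inv_cancel_right]
  by_cases hall : ∀ x ∈ A, (Subgroup.zpowers x).Normal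
  · exact Or.inl (hL.inFamilyOne hG hb hall)
  · exact Or.inr (hL.inFamilyTwo hG hb hall)

/-- A bound on the exponent of a self-centralizing normal abelian subgroup bounds the order of
the group. -/
theorem card_le_of_small_exponent {G : Type*} [Group G] [Finite G]
    (hnd : ¬ IsDedekindGroup G) {k n : ℕ}
    (hC : ∀ g : G, ¬ (Subgroup.zpowers g).Normal →
      Nat.card (Subgroup.centralizer {g}) ≤ 2 ^ k * orderOf g)
    (A : Subgroup G) (hN : A.Normal) (hc : ∀ x ∈ A, ∀ y ∈ A, x * y = y * x)
    (hself : ∀ g : G, (∀ x ∈ A, g * x = x * g) → g ∈ A)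
    (hexp : Monoid.exponent A = 2 ^ n) :
    Nat.card G ≤ 2 ^ ((2 * k + 2) * n + (2 * k + 2) * n * ((2 * k + 2) * n)) := by
  let _ : CommGroup A :=
    { (inferInstance : Group A) with
      mul_comm := fun x y => Subtype.ext (hc x x.2 y y.2) }
  refine card_le_of_selfCentralizing A hN hself ?_
  rw [pow_mul]
  refine card_le_pow_of_card_involutions_le n (fun x => hexp ▸ Monoid.pow_exponent_eq_one x) ?_
  set E : Subgroup A := (powMonoidHom 2 : A →* A).ker with hE
  have hE2 : ∀ x ∈ E.map A.subtype, x ^ 2 = 1 := by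
    rintro _ ⟨y, hy, rfl⟩
    exact congrArg Subtype.val (MonoidHom.mem_ker.1 hy)
  have hEA : E.map A.subtype ≤ A := Subgroup.map_subtype_le E
  rw [← Subgroup.card_map_of_injective A.subtype_injective]
  refine card_elementary_le hC hnd _ ⟨fun x hx g => ?_⟩
    (fun x hx y hy => hc x (hEA hx) y (hEA hy)) hE2
  refine ⟨⟨g * x * g⁻¹, hN.conj_mem x (hEA hx) g⟩, ?_, rfl⟩
  refine MonoidHom.mem_ker.2 (Subtype.ext ?_)
  change (g * x * g⁻¹) ^ 2 = 1
  rw [conj_pow, hE2 x hx]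
  group

theorem theoremB :
    ∃ f : Polynomial ℕ, f.natDegree = 4 ∧
      ∀ (k : ℕ) (G : Type*) [Group G] [Finite G],
        IsPGroup 2 G → ¬ IsDedekindGroup G →
        (mni G = 2 ^ k ∨ mniStar G = 2 ^ k ∨ mciStar G = 2 ^ k) →
        2 ^ f.eval k < Nat.card G →
        InFamilyOne G ∨ InFamilyTwo G := by
  refine ⟨Polynomial.C 72 * (Polynomial.X + Polynomial.C 1) ^ 4, ?_, ?_⟩
  · rw [Polynomial.natDegree_C_mul (by norm_num), Polynomial.natDegree_pow,
      Polynomial.natDegree_X_add_C]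
  · intro k G _ _ hG hnd hinv hcard
    have hC := card_centralizer_le hinv
    obtain ⟨A, hN, hc, hself⟩ := exists_normal_abelian_selfCentralizing hG
    obtain ⟨n, hn⟩ := (isPGroup_iff_exponent_eq_pow).1 (hG.to_subgroup A)
    refine inFamily_of_large_exponent hG hnd hC A hN hc hself hn ?_
    by_contra hsmall
    refine hcard.not_ge ((card_le_of_small_exponent hnd hC A hN hc hself hn).trans
      (Nat.pow_le_pow_right two_pos ?_))
    -- with `n ≤ 3 * k + 4`, the rank times the exponent is at most `8 * (k + 1) ^ 2`
    have h1 : (2 * k + 2) * n ≤ 8 * (k + 1) ^ 2 := by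
      calc (2 * k + 2) * n ≤ (2 * k + 2) * (4 * (k + 1)) := Nat.mul_le_mul_left _ (by omega)
        _ = 8 * (k + 1) ^ 2 := by ring
    have h2 : (k + 1) ^ 2 ≤ (k + 1) ^ 4 := Nat.pow_le_pow_right (by omega) (by norm_num)
    have h3 := Nat.mul_le_mul h1 h1
    have h4 : 8 * (k + 1) ^ 2 * (8 * (k + 1) ^ 2) = 64 * (k + 1) ^ 4 := by ring
    simp only [Polynomial.eval_mul, Polynomial.eval_C, Polynomial.eval_pow, Polynomial.eval_add,
      Polynomial.eval_X]
    omega
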